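/- Let $n\in\mathbb{N}$. For Borel probability measures $\mu,\nu$ on $\mathbb{R}^n$ let $$\mathbb{W}_2^2(\mu,\nu)=\inf_{\pi\in\Pi(\mu,\nu)}\int \tfrac12\|x-y\|_2^2\,d\pi(x,y),$$ where $\Pi(\mu,\nu)$ is the set of couplings of $\mu$ and $\nu$. For a class $\mathcal{F}$ of convex functions on $\mathbb{R}^n$ let $$\mathbb{W}_{2,\mathcal{F}}^2(\mu,\nu)=\int \tfrac12\|x\|_2^2\,d\mu(x)+\int \tfrac12\|y\|_2^2\,d\nu(y)-\inf_{f\in\mathcal{F}}\Bigl(\int f\,d\mu+\int f^\star\,d\nu\Bigr),\qquad f^\star(y)=\sup_{x}\bigl(\langle x,y\rangle-f(x)\bigr),$$ with $\mathbb{W}_2,\mathbb{W}_{2,\mathcal{F}}$ the nonnegative square roots. Let $\mathcal{Q}$ be the class of all functions $x\mapsto\frac12x^\top Ax+b^\top x$ with $A\in\mathbb{R}^{n\times n}$ symmetric positive definite and $b\in\mathbb{R}^n$. Let $\mathcal{P}_{2,+}(\mathbb{R}^n)$ be the set of probability measures on $\mathbb{R}^n$ with finite second moment and positive definite covariance matrix,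 and for $\mu\in\mathcal{P}_{2,+}(\mathbb{R}^n)$ let $G(\mu)$ be the Gaussian measure with the same mean and covariance matrix as $\mu$. Then: 1. For all $\mu,\nu\in\mathcal{P}_{2,+}(\mathbb{R}^n)$, the quantity $\mathbb{W}_{2,\mathcal{Q}}(\mu,\nu)$ is well defined (for every $f\in\mathcal{Q}$ the conjugate $f^\star$ is finite and $f\in L^1(\mu)$, $f^\star\in L^1(\nu)$; the infimum is finite; and $\mathbb{W}_{2,\mathcal{Q}}^2(\mu,\nu)\ge 0$), and $$\mathbb{W}_{2,\mathcal{Q}}(\mu,\nu)=\mathbb{W}_2(G(\mu),G(\nu)).$$ 2. $\mathbb{W}_{2,\mathcal{Q}}$ is a pseudometric on $\mathcal{P}_{2,+}(\mathbb{R}^n)$. 3. $\mathbb{W}_{2,\mathcal{Q}}$ is a metric on the set of Gaussian measures on $\mathbb{R}^n$ with positive definite covariance matrix. -/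

import Mathlib

open MeasureTheory ProbabilityTheory
open scoped ENNReal RealInnerProductSpace Matrix

noncomputable section

namespace QuadOT

/-- `ℝⁿ` with the Euclidean norm. -/
abbrev E (n : ℕ) : Type := EuclideanSpace ℝ (Fin n)

/-! ### The Wasserstein distance with cost `½ ‖x - y‖²` -/

/-- The couplings of `μ` and `ν`: measures on the product with marginals `μ` and `ν`. -/
def couplings {n : ℕ} (μ ν : Measure (E n)) : Set (Measure (E n × E n)) :=
  {π | π.fst = μ ∧ π.snd = ν}

/-- `W₂²(μ, ν) = inf_π ∫ ½ ‖x - y‖² dπ(x, y)`, as an extended nonnegative number. -/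
def W2Sq {n : ℕ} (μ ν : Measure (E n)) : ℝ≥0∞ :=
  ⨅ π ∈ couplings μ ν, ∫⁻ z, ENNReal.ofReal (1 / 2 * ‖z.1 - z.2‖ ^ 2) ∂π

/-- `W₂(μ, ν)`, as an extended nonnegative number. -/
def W2 {n : ℕ} (μ ν : Measure (E n)) : ℝ≥0∞ :=
  (W2Sq μ ν) ^ (1 / 2 : ℝ)

/-! ### The approximation of `W₂` given by a class `F` of convex functions -/

/-- The convex conjugate `f⋆(y) = sup_x (⟨x, y⟩ - f x)`. -/
def conj {n : ℕ} (f : E n → ℝ) (y : E n) : ℝ :=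
  ⨆ x : E n, (⟪x, y⟫ - f x)

/-- The restricted dual objective `∫ f dμ + ∫ f⋆ dν`. -/
def J {n : ℕ} (μ ν : Measure (E n)) (f : E n → ℝ) : ℝ :=
  ∫ x, f x ∂μ + ∫ y, conj f y ∂ν

/-- `W²_{2,F}(μ, ν) = ∫ ½ ‖x‖² dμ + ∫ ½ ‖y‖² dν - inf_{f ∈ F} J(f)`. -/
def W2FSq {n : ℕ} (F : Set (E n → ℝ)) (μ ν : Measure (E n)) : ℝ :=
  ∫ x, 1 / 2 * ‖x‖ ^ 2 ∂μ + ∫ y, 1 / 2 * ‖y‖ ^ 2 ∂ν - ⨅ f : F, J μ ν f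

/-- `W_{2,F}(μ, ν)`. -/
def W2F {n : ℕ} (F : Set (E n → ℝ)) (μ ν : Measure (E n)) : ℝ :=
  √(W2FSq F μ ν)

/-- All the suprema, integrals, infima and square roots that enter `W_{2,F}(μ, ν)` are genuine,
so that no default value occurs in its definition. -/
structure W2FWellDefined {n : ℕ} (F : Set (E n → ℝ)) (μ ν : Measure (E n)) : Prop where
  nonempty : F.Nonempty
  conj_finite : ∀ f ∈ F, ∀ y : E n, BddAbove (Set.range fun x : E n => ⟪x, y⟫ - f x)
  integrable : ∀ f ∈ F, Integrable f μ
  integrable_conj : ∀ f ∈ F, Integrable (conj f) ν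
  integrable_sq_left : Integrable (fun x : E n => 1 / 2 * ‖x‖ ^ 2) μ
  integrable_sq_right : Integrable (fun y : E n => 1 / 2 * ‖y‖ ^ 2) ν
  bddBelow : BddBelow (J μ ν '' F)
  nonneg : 0 ≤ W2FSq F μ ν

/-! ### Convex quadratic functions -/

/-- The quadratic function `x ↦ ½ xᵀ A x + bᵀ x` with parameter `θ = (A, b)`. -/
def quad {n : ℕ} (θ : Matrix (Fin n) (Fin n) ℝ × E n) (x : E n) : ℝ :=
  1 / 2 * (x.ofLp ⬝ᵥ (θ.1 *ᵥ x.ofLp)) + θ.2.ofLp ⬝ᵥ x.ofLp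

/-- The class of quadratic functions with parameters in `Θ`. -/
def Q {n : ℕ} (Θ : Set (Matrix (Fin n) (Fin n) ℝ × E n)) : Set (E n → ℝ) :=
  quad '' Θ

/-- The full parameter set: a positive definite matrix and an arbitrary vector. -/
def fullΘ (n : ℕ) : Set (Matrix (Fin n) (Fin n) ℝ × E n) :=
  {θ | θ.1.PosDef}

/-! ### Moments and Gaussians -/

/-- The mean vector. -/
def mean {n : ℕ} (μ : Measure (E n)) : E n :=
  ∫ x, x ∂μ

/-- The covariance matrix. -/
def covMatrix {n : ℕ} (μ : Measure (E n)) : Matrix (Fin n) (Fin n) ℝ :=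
  Matrix.of fun i j => cov[fun x : E n => x i, fun x : E n => x j; μ]

/-- Probability measures with finite second moment and positive definite covariance matrix. -/
def P2plus (n : ℕ) : Set (Measure (E n)) :=
  {μ | IsProbabilityMeasure μ ∧ MemLp (fun x : E n => x) 2 μ ∧ (covMatrix μ).PosDef}

/-- The Gaussian measure with the same mean and covariance matrix as `μ`. -/
def G {n : ℕ} (μ : Measure (E n)) : Measure (E n) :=
  multivariateGaussian (mean μ) (covMatrix μ)

/-- Gaussian measures with positive definite covariance matrix. -/
def nondegGaussians (n : ℕ) : Set (Measure (E n)) :=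
  {μ | IsGaussian μ ∧ (covMatrix μ).PosDef}

/-! ### Pseudometrics and metrics on a set -/

/-- `d` restricts to a pseudometric on `S`. -/
structure IsPseudometricOn {α : Type*} (S : Set α) (d : α → α → ℝ) : Prop where
  nonneg : ∀ x ∈ S, ∀ y ∈ S, 0 ≤ d x y
  self : ∀ x ∈ S, d x x = 0
  symm : ∀ x ∈ S, ∀ y ∈ S, d x y = d y x
  triangle : ∀ x ∈ S, ∀ y ∈ S, ∀ z ∈ S, d x z ≤ d x y + d y z

/-- `d` restricts to a metric on `S`. -/
structure IsMetricOn {α : Type*} (S : Set α) (d : α → α → ℝ) : Prop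
    extends IsPseudometricOn S d where
  eq_of_eq_zero : ∀ x ∈ S, ∀ y ∈ S, d x y = 0 → x = y

end QuadOT

end

namespace QuadOT

variable {n : ℕ}

/-! The conjugate of a convex quadratic is again quadratic, so `J μ ν f` for `f` in the class sees
only the means and covariance matrices of `μ` and `ν` (`W2FSq_congr`), and both measures may be
replaced by their Gaussians.

Two nondegenerate Gaussians with covariances `S₁`, `S₂` are related by a map `T x = b + A x`, where
`A` is positive definite and `A S₁ A = S₂` (`exists_affineMap_map_G_eq`). This `T` is the gradient
of `quad (A, b)`. For every coupling and every `f` in the class, cost minus dual value is the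
integral of the Fenchel–Young gap `f x + f⋆ y - ⟪x, y⟫ ≥ 0` (`integral_cost_eq`). For `quad (A, b)`
the gap vanishes on the graph of `T`, so the graph coupling and `quad (A, b)` certify each other's
optimality, and the restricted dual has no duality gap (`duality_of_map_eq`).

Because optimal couplings here are given by maps, `W2` between Gaussians is a constant times the
`L²` norm of `x - T x`. The triangle inequality is then Minkowski's inequality for a composed map,
with no gluing of couplings; distance zero forces `T = id` almost everywhere. -/

open scoped MatrixOrder in
/-- Given positive definite `S₁` and `S₂`, the equation `A S₁ A = S₂` has a positive definite
solution. -/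
lemma exists_posDef_mul_mul_eq {S₁ S₂ : Matrix (Fin n) (Fin n) ℝ} (h₁ : S₁.PosDef)
    (h₂ : S₂.PosDef) : ∃ A : Matrix (Fin n) (Fin n) ℝ, A.PosDef ∧ A * S₁ * A = S₂ := by
  have sqrt_posDef : ∀ {S : Matrix (Fin n) (Fin n) ℝ}, S.PosDef → (CFC.sqrt S).PosDef :=
    fun {S} h => ((Matrix.nonneg_iff_posSemidef.1 (CFC.sqrt_nonneg S)).posDef_iff_isUnit).2
      ((CFC.isUnit_sqrt_iff S h.posSemidef.nonneg).2 h.isUnit)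
  have conj_posDef : ∀ {R S : Matrix (Fin n) (Fin n) ℝ}, R.PosDef → S.PosDef →
      (R * S * R).PosDef := fun {R S} hR hS => by
    have h := hS.mul_mul_conjTranspose_same (B := R)
      (Matrix.vecMul_injective_iff_isUnit.2 hR.isUnit)
    rwa [hR.isHermitian.eq] at h
  set R := CFC.sqrt S₁
  have hRpos : R.PosDef := sqrt_posDef h₁
  have hRR : R * R = S₁ := CFC.sqrt_mul_sqrt_self S₁ h₁.posSemidef.nonneg
  have hC := conj_posDef hRpos h₂
  set M := CFC.sqrt (R * S₂ * R)
  have hMM : M * M = R * S₂ * R := CFC.sqrt_mul_sqrt_self _ hC.posSemidef.nonneg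
  have hdet : IsUnit R.det := (Matrix.isUnit_iff_isUnit_det R).1 hRpos.isUnit
  have hl := Matrix.nonsing_inv_mul R hdet
  have hr := Matrix.mul_nonsing_inv R hdet
  -- With `R = S₁^{1/2}` the equation reads `(R A R)² = R S₂ R`, so `R A R` is taken to be the
  -- square root `M`.
  refine ⟨R⁻¹ * M * R⁻¹, conj_posDef hRpos.inv (sqrt_posDef hC), ?_⟩
  calc R⁻¹ * M * R⁻¹ * S₁ * (R⁻¹ * M * R⁻¹)
      = R⁻¹ * M * (R⁻¹ * R) * (R * R⁻¹) * M * R⁻¹ := by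
        rw [← hRR]; simp only [Matrix.mul_assoc]
    _ = R⁻¹ * (M * M) * R⁻¹ := by
        rw [hl, hr]; simp only [Matrix.mul_assoc, Matrix.mul_one]
    _ = (R⁻¹ * R) * S₂ * (R * R⁻¹) := by rw [hMM]; simp only [Matrix.mul_assoc]
    _ = S₂ := by rw [hl, hr]; simp

/-! ### Conjugates of quadratic functions -/

lemma dotProduct_mulVec_comm {A : Matrix (Fin n) (Fin n) ℝ} (hA : A.IsHermitian)
    (u v : Fin n → ℝ) : u ⬝ᵥ (A *ᵥ v) = v ⬝ᵥ (A *ᵥ u) := by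
  have h : Aᵀ = A := by rw [← Matrix.conjTranspose_eq_transpose_of_trivial, hA.eq]
  rw [Matrix.dotProduct_mulVec, ← Matrix.mulVec_transpose, h, dotProduct_comm]

lemma inner_eq_dotProduct (x y : E n) : ⟪x, y⟫ = x.ofLp ⬝ᵥ y.ofLp := by
  simp [PiLp.inner_apply, dotProduct, mul_comm]

/-- The parameter of the quadratic part of the conjugate of `quad θ`. -/
noncomputable def conjParam (θ : Matrix (Fin n) (Fin n) ℝ × E n) : Matrix (Fin n) (Fin n) ℝ × E n :=
  (θ.1⁻¹, WithLp.toLp 2 (-(θ.1⁻¹ *ᵥ θ.2.ofLp)))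

/-- The constant term of the conjugate of `quad θ`. -/
noncomputable def conjConst (θ : Matrix (Fin n) (Fin n) ℝ × E n) : ℝ :=
  1 / 2 * (θ.2.ofLp ⬝ᵥ (θ.1⁻¹ *ᵥ θ.2.ofLp))

/-- The Fenchel–Young gap of `quad (A, b)` is a quadratic form. -/
lemma quad_add_quad_conjParam {A : Matrix (Fin n) (Fin n) ℝ} (hA : A.PosDef) (b x y : E n) :
    quad (A, b) x + (quad (conjParam (A, b)) y + conjConst (A, b)) - ⟪x, y⟫ =
      1 / 2 * ((x.ofLp - A⁻¹ *ᵥ (y.ofLp - b.ofLp)) ⬝ᵥ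
        (A *ᵥ (x.ofLp - A⁻¹ *ᵥ (y.ofLp - b.ofLp)))) := by
  have hdet : IsUnit A.det := (Matrix.isUnit_iff_isUnit_det A).1 hA.isUnit
  obtain ⟨w, hw⟩ : ∃ w, w = y.ofLp - b.ofLp := ⟨_, rfl⟩
  have hy : y.ofLp = w + b.ofLp := by simp [hw]
  have hAv : A *ᵥ (A⁻¹ *ᵥ w) = w := by
    rw [Matrix.mulVec_mulVec, Matrix.mul_nonsing_inv A hdet, Matrix.one_mulVec]
  have h₁ := dotProduct_mulVec_comm hA.inv.isHermitian w b.ofLp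
  have h₂ := dotProduct_mulVec_comm hA.isHermitian (A⁻¹ *ᵥ w) x.ofLp
  rw [hAv] at h₂
  have h₃ := dotProduct_comm w (A⁻¹ *ᵥ w)
  have h₄ := dotProduct_comm b.ofLp x.ofLp
  have h₅ := dotProduct_comm (A⁻¹ *ᵥ b.ofLp) w
  have h₆ := dotProduct_comm (A⁻¹ *ᵥ b.ofLp) b.ofLp
  rw [← hw, inner_eq_dotProduct]
  simp only [quad, conjParam, conjConst, hy, Matrix.mulVec_sub, Matrix.mulVec_add, hAv,
    dotProduct_add, add_dotProduct, dotProduct_sub, sub_dotProduct, neg_dotProduct]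
  linarith

lemma inner_le_quad_add {A : Matrix (Fin n) (Fin n) ℝ} (hA : A.PosDef) (b x y : E n) :
    ⟪x, y⟫ ≤ quad (A, b) x + (quad (conjParam (A, b)) y + conjConst (A, b)) := by
  have h := quad_add_quad_conjParam hA b x y
  have h' := hA.posSemidef.dotProduct_mulVec_nonneg (x.ofLp - A⁻¹ *ᵥ (y.ofLp - b.ofLp))
  rw [star_trivial] at h'
  linarith

/-- Equality in Fenchel–Young holds along the gradient of `quad (A, b)`. -/
lemma inner_eq_quad_add {A : Matrix (Fin n) (Fin n) ℝ} (hA : A.PosDef) (b x y : E n)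
    (hy : y.ofLp = b.ofLp + A *ᵥ x.ofLp) :
    ⟪x, y⟫ = quad (A, b) x + (quad (conjParam (A, b)) y + conjConst (A, b)) := by
  have h := quad_add_quad_conjParam hA b x y
  have hdet : IsUnit A.det := (Matrix.isUnit_iff_isUnit_det A).1 hA.isUnit
  have h' : x.ofLp - A⁻¹ *ᵥ (y.ofLp - b.ofLp) = 0 := by
    rw [hy, add_sub_cancel_left, Matrix.mulVec_mulVec, Matrix.nonsing_inv_mul A hdet,
      Matrix.one_mulVec, sub_self]
  rw [h', zero_dotProduct] at h
  linarith

lemma bddAbove_conj_quad {A : Matrix (Fin n) (Fin n) ℝ} (hA : A.PosDef) (b y : E n) :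
    BddAbove (Set.range fun x : E n => ⟪x, y⟫ - quad (A, b) x) := by
  refine ⟨quad (conjParam (A, b)) y + conjConst (A, b), ?_⟩
  rintro _ ⟨x, rfl⟩
  have := inner_le_quad_add hA b x y
  simp only
  linarith

lemma conj_quad {A : Matrix (Fin n) (Fin n) ℝ} (hA : A.PosDef) (b y : E n) :
    conj (quad (A, b)) y = quad (conjParam (A, b)) y + conjConst (A, b) := by
  have hdet : IsUnit A.det := (Matrix.isUnit_iff_isUnit_det A).1 hA.isUnit
  refine le_antisymm (ciSup_le fun x => ?_) ?_
  · have := inner_le_quad_add hA b x y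
    linarith
  · refine le_trans (le_of_eq ?_)
      -- The supremum is attained where the gradient `b + A x` equals `y`.
      (le_ciSup (bddAbove_conj_quad hA b y) (WithLp.toLp 2 (A⁻¹ *ᵥ (y.ofLp - b.ofLp))))
    rw [inner_eq_quad_add hA b _ y]
    · ring
    · rw [Matrix.mulVec_mulVec, Matrix.mul_nonsing_inv A hdet, Matrix.one_mulVec]
      simp

/-! ### Integrals of quadratic functions -/

section moments

variable {μ ν : Measure (E n)}

lemma memLp_eval (h : MemLp (fun x : E n => x) 2 μ) (i : Fin n) :
    MemLp (fun x : E n => x i) 2 μ :=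
  (EuclideanSpace.proj i : E n →L[ℝ] ℝ).comp_memLp' h

lemma integrable_eval_mul_eval (h : MemLp (fun x : E n => x) 2 μ) (i j : Fin n) :
    Integrable (fun x : E n => x i * x j) μ :=
  (memLp_eval h i).integrable_mul (memLp_eval h j)

lemma integrable_eval [IsProbabilityMeasure μ] (h : MemLp (fun x : E n => x) 2 μ) (i : Fin n) :
    Integrable (fun x : E n => x i) μ :=
  (memLp_eval h i).integrable (by norm_num)

lemma integral_eval [IsProbabilityMeasure μ] (h : MemLp (fun x : E n => x) 2 μ) (i : Fin n) :
    ∫ x : E n, x i ∂μ = mean μ i :=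
  (EuclideanSpace.proj i : E n →L[ℝ] ℝ).integral_comp_comm
    (h.integrable (by norm_num))

lemma integral_eval_mul_eval [IsProbabilityMeasure μ] (h : MemLp (fun x : E n => x) 2 μ)
    (i j : Fin n) : ∫ x : E n, x i * x j ∂μ = covMatrix μ i j + mean μ i * mean μ j := by
  have := covariance_eq_sub (memLp_eval h i) (memLp_eval h j)
  simp only [Pi.mul_apply, integral_eval h] at this
  simp [covMatrix, this]

lemma quad_eq_sum (θ : Matrix (Fin n) (Fin n) ℝ × E n) :
    quad θ = fun x : E n => ∑ i, ∑ j, 1 / 2 * θ.1 i j * (x i * x j) + ∑ i, θ.2 i * x i := by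
  ext x
  simp only [quad, dotProduct, Matrix.mulVec, Finset.mul_sum]
  congr 1
  exact Finset.sum_congr rfl fun i _ => Finset.sum_congr rfl fun j _ => by ring

lemma integrable_quad [IsProbabilityMeasure μ] (h : MemLp (fun x : E n => x) 2 μ)
    (θ : Matrix (Fin n) (Fin n) ℝ × E n) : Integrable (quad θ) μ := by
  rw [quad_eq_sum]
  exact (integrable_finsetSum _ fun i _ => integrable_finsetSum _ fun j _ =>
    (integrable_eval_mul_eval h i j).const_mul _).add
      (integrable_finsetSum _ fun i _ => (integrable_eval h i).const_mul _)

lemma integral_quad [IsProbabilityMeasure μ] (h : MemLp (fun x : E n => x) 2 μ)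
    (θ : Matrix (Fin n) (Fin n) ℝ × E n) :
    ∫ x, quad θ x ∂μ =
      ∑ i, ∑ j, 1 / 2 * θ.1 i j * (covMatrix μ i j + mean μ i * mean μ j) +
        ∑ i, θ.2 i * mean μ i := by
  have h₂ (i j : Fin n) := (integrable_eval_mul_eval h i j).const_mul (1 / 2 * θ.1 i j)
  have h₁ (i : Fin n) := (integrable_eval h i).const_mul (θ.2 i)
  rw [quad_eq_sum, integral_add
    (integrable_finsetSum _ fun i _ => integrable_finsetSum _ fun j _ => h₂ i j)
    (integrable_finsetSum _ fun i _ => h₁ i),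
    integral_finsetSum _ fun i _ => integrable_finsetSum _ fun j _ => h₂ i j,
    integral_finsetSum _ fun i _ => h₁ i]
  simp_rw [integral_finsetSum _ fun j _ => h₂ _ j, integral_const_mul, integral_eval h,
    integral_eval_mul_eval h]

/-- Lets the second-moment terms of `W2FSq` and the transport cost be handled by the same integral
lemmas as the class itself. -/
lemma half_norm_sq_eq_quad : (fun x : E n => 1 / 2 * ‖x‖ ^ 2) = quad (1, 0) := by
  ext x
  rw [← real_inner_self_eq_norm_sq, inner_eq_dotProduct]
  simp [quad]

lemma integral_quad_congr {μ' : Measure (E n)} [IsProbabilityMeasure μ] [IsProbabilityMeasure μ']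
    (h : MemLp (fun x : E n => x) 2 μ) (h' : MemLp (fun x : E n => x) 2 μ')
    (hm : mean μ = mean μ') (hc : covMatrix μ = covMatrix μ')
    (θ : Matrix (Fin n) (Fin n) ℝ × E n) : ∫ x, quad θ x ∂μ = ∫ x, quad θ x ∂μ' := by
  rw [integral_quad h, integral_quad h', hm, hc]

lemma integrable_conj_quad [IsProbabilityMeasure ν] (h : MemLp (fun x : E n => x) 2 ν)
    {A : Matrix (Fin n) (Fin n) ℝ} (hA : A.PosDef) (b : E n) :
    Integrable (conj (quad (A, b))) ν := by
  rw [funext (conj_quad hA b)]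
  exact (integrable_quad h _).add (integrable_const _)

lemma J_quad [IsProbabilityMeasure ν] (h : MemLp (fun x : E n => x) 2 ν)
    {A : Matrix (Fin n) (Fin n) ℝ} (hA : A.PosDef) (b : E n) :
    J μ ν (quad (A, b)) =
      ∫ x, quad (A, b) x ∂μ + (∫ y, quad (conjParam (A, b)) y ∂ν + conjConst (A, b)) := by
  rw [J, funext (conj_quad hA b), integral_add (integrable_quad h _) (integrable_const _)]
  simp

/-- `W2FSq` over the quadratic class depends only on means and covariance matrices. -/
lemma W2FSq_congr {μ' ν' : Measure (E n)} [IsProbabilityMeasure μ] [IsProbabilityMeasure μ']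
    [IsProbabilityMeasure ν] [IsProbabilityMeasure ν']
    (hμ : MemLp (fun x : E n => x) 2 μ) (hμ' : MemLp (fun x : E n => x) 2 μ')
    (hν : MemLp (fun x : E n => x) 2 ν) (hν' : MemLp (fun x : E n => x) 2 ν')
    (hm : mean μ = mean μ') (hc : covMatrix μ = covMatrix μ')
    (hm' : mean ν = mean ν') (hc' : covMatrix ν = covMatrix ν') :
    W2FSq (Q (fullΘ n)) μ ν = W2FSq (Q (fullΘ n)) μ' ν' := by
  have hJ : ∀ f : Q (fullΘ n), J μ ν f = J μ' ν' f := by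
    rintro ⟨_, ⟨A, b⟩, hA, rfl⟩
    rw [J_quad hν hA, J_quad hν' hA, integral_quad_congr hμ hμ' hm hc,
      integral_quad_congr hν hν' hm' hc']
  simp only [W2FSq, half_norm_sq_eq_quad, hJ]
  rw [integral_quad_congr hμ hμ' hm hc, integral_quad_congr hν hν' hm' hc']

/-! ### Duality for couplings -/

/-- The cost of a coupling equals the dual value plus the integral of the Fenchel–Young gap. -/
lemma integral_cost_eq [IsProbabilityMeasure μ] [IsProbabilityMeasure ν]
    (hμ : MemLp (fun x : E n => x) 2 μ) (hν : MemLp (fun x : E n => x) 2 ν)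
    {π : Measure (E n × E n)} (hπ : π ∈ couplings μ ν)
    {A : Matrix (Fin n) (Fin n) ℝ} (hA : A.PosDef) (b : E n) :
    Integrable (fun z : E n × E n => 1 / 2 * ‖z.1 - z.2‖ ^ 2) π ∧
    ∫ z, 1 / 2 * ‖z.1 - z.2‖ ^ 2 ∂π =
      ∫ x, 1 / 2 * ‖x‖ ^ 2 ∂μ + ∫ y, 1 / 2 * ‖y‖ ^ 2 ∂ν - J μ ν (quad (A, b)) +
        ∫ z, (quad (A, b) z.1 + (quad (conjParam (A, b)) z.2 + conjConst (A, b)) - ⟪z.1, z.2⟫)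
          ∂π := by
  have hfst : MeasurePreserving Prod.fst π μ := ⟨measurable_fst, hπ.1⟩
  have hsnd : MeasurePreserving Prod.snd π ν := ⟨measurable_snd, hπ.2⟩
  have : IsProbabilityMeasure π := ⟨by
    rw [← Set.preimage_univ (f := Prod.fst),
      hfst.measure_preimage MeasurableSet.univ.nullMeasurableSet, measure_univ]⟩
  have hq₁ (θ : Matrix (Fin n) (Fin n) ℝ × E n) :
      Integrable (fun z : E n × E n => quad θ z.1) π :=
    hfst.integrable_comp_of_integrable (integrable_quad hμ θ)
  have hq₂ (θ : Matrix (Fin n) (Fin n) ℝ × E n) :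
      Integrable (fun z : E n × E n => quad θ z.2) π :=
    hsnd.integrable_comp_of_integrable (integrable_quad hν θ)
  have hi₁ (θ : Matrix (Fin n) (Fin n) ℝ × E n) :
      ∫ z, quad θ z.1 ∂π = ∫ x, quad θ x ∂μ := by
    rw [← hπ.1, Measure.fst, integral_map measurable_fst.aemeasurable]
    exact (hπ.1 ▸ integrable_quad hμ θ : Integrable (quad θ) π.fst).aestronglyMeasurable
  have hi₂ (θ : Matrix (Fin n) (Fin n) ℝ × E n) :
      ∫ z, quad θ z.2 ∂π = ∫ x, quad θ x ∂ν := by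
    rw [← hπ.2, Measure.snd, integral_map measurable_snd.aemeasurable]
    exact (hπ.2 ▸ integrable_quad hν θ : Integrable (quad θ) π.snd).aestronglyMeasurable
  have hin : Integrable (fun z : E n × E n => ⟪z.1, z.2⟫) π := by
    simp_rw [inner_eq_dotProduct, dotProduct]
    exact integrable_finsetSum _ fun i _ =>
      ((memLp_eval hμ i).comp_measurePreserving hfst).integrable_mul
        ((memLp_eval hν i).comp_measurePreserving hsnd)
  have hcost : (fun z : E n × E n => 1 / 2 * ‖z.1 - z.2‖ ^ 2) =
      fun z => quad (1, 0) z.1 + quad (1, 0) z.2 - ⟪z.1, z.2⟫ := by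
    ext z
    rw [← half_norm_sq_eq_quad, norm_sub_sq_real]
    ring
  refine ⟨hcost ▸ ((hq₁ _).add (hq₂ _)).sub hin, ?_⟩
  rw [hcost, J_quad hν hA, half_norm_sq_eq_quad,
    integral_sub (by exact (hq₁ _).add (hq₂ _)) hin, integral_add (hq₁ _) (hq₂ _),
    integral_sub (by exact (hq₁ _).add ((hq₂ _).add (integrable_const _))) hin,
    integral_add (hq₁ _) (by exact (hq₂ _).add (integrable_const _)),
    integral_add (hq₂ _) (integrable_const _), hi₁, hi₁, hi₂, hi₂]
  simp

/-- Weak duality. -/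
lemma dual_le_integral_cost [IsProbabilityMeasure μ] [IsProbabilityMeasure ν]
    (hμ : MemLp (fun x : E n => x) 2 μ) (hν : MemLp (fun x : E n => x) 2 ν)
    {π : Measure (E n × E n)} (hπ : π ∈ couplings μ ν)
    {A : Matrix (Fin n) (Fin n) ℝ} (hA : A.PosDef) (b : E n) :
    ∫ x, 1 / 2 * ‖x‖ ^ 2 ∂μ + ∫ y, 1 / 2 * ‖y‖ ^ 2 ∂ν - J μ ν (quad (A, b)) ≤
      ∫ z, 1 / 2 * ‖z.1 - z.2‖ ^ 2 ∂π := by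
  rw [(integral_cost_eq hμ hν hπ hA b).2]
  exact le_add_of_nonneg_right
    (integral_nonneg fun z => sub_nonneg.2 (inner_le_quad_add hA b z.1 z.2))

/-- The affine map `x ↦ b + A x`. -/
noncomputable def affineMap (A : Matrix (Fin n) (Fin n) ℝ) (b x : E n) : E n :=
  b + Matrix.toEuclideanCLM (𝕜 := ℝ) A x

lemma continuous_affineMap (A : Matrix (Fin n) (Fin n) ℝ) (b : E n) :
    Continuous (affineMap A b) := by
  unfold affineMap
  fun_prop

lemma map_prodMk_mem_couplings {T : E n → E n} (hT : Measurable T) :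
    μ.map (fun x => (x, T x)) ∈ couplings μ (μ.map T) := by
  have h : Measurable fun x => (x, T x) := measurable_id.prodMk hT
  refine ⟨?_, ?_⟩
  · rw [Measure.fst, Measure.map_map measurable_fst h]
    exact Measure.map_id
  · rw [Measure.snd, Measure.map_map measurable_snd h]
    rfl

lemma lintegral_cost_map {T : E n → E n} (hT : Measurable T) :
    ∫⁻ z, ENNReal.ofReal (1 / 2 * ‖z.1 - z.2‖ ^ 2) ∂(μ.map fun x => (x, T x)) =
      ∫⁻ x, ENNReal.ofReal (1 / 2 * ‖x - T x‖ ^ 2) ∂μ := by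
  rw [lintegral_map (by fun_prop) (by fun_prop)]

/-- Strong duality for two measures related by the gradient of a convex quadratic function. -/
theorem duality_of_map_eq [IsProbabilityMeasure μ] [IsProbabilityMeasure ν]
    (hμ : MemLp (fun x : E n => x) 2 μ) (hν : MemLp (fun x : E n => x) 2 ν)
    {A : Matrix (Fin n) (Fin n) ℝ} (hA : A.PosDef) (b : E n) (hT : μ.map (affineMap A b) = ν) :
    W2Sq μ ν = ENNReal.ofReal (W2FSq (Q (fullΘ n)) μ ν) ∧ 0 ≤ W2FSq (Q (fullΘ n)) μ ν ∧
    BddBelow (J μ ν '' Q (fullΘ n)) ∧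
    W2Sq μ ν = ∫⁻ x, ENNReal.ofReal (1 / 2 * ‖x - affineMap A b x‖ ^ 2) ∂μ := by
  have hTm := (continuous_affineMap A b).measurable
  set π₀ := μ.map (fun x => (x, affineMap A b x)) with hπ₀
  have hπ : π₀ ∈ couplings μ ν := hT ▸ map_prodMk_mem_couplings hTm
  have hcost₀ : ∫ z, 1 / 2 * ‖z.1 - z.2‖ ^ 2 ∂π₀ =
      ∫ x, 1 / 2 * ‖x‖ ^ 2 ∂μ + ∫ y, 1 / 2 * ‖y‖ ^ 2 ∂ν - J μ ν (quad (A, b)) := by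
    rw [(integral_cost_eq hμ hν hπ hA b).2, add_eq_left]
    refine integral_eq_zero_of_ae ?_
    have hae : ∀ᵐ z ∂π₀, z.2 = affineMap A b z.1 := by
      rw [hπ₀, ae_map_iff (by fun_prop)
        (measurableSet_eq_fun measurable_snd (by fun_prop))]
      exact Filter.Eventually.of_forall fun _ => rfl
    filter_upwards [hae] with z hz
    rw [Pi.zero_apply, sub_eq_zero, inner_eq_quad_add hA b z.1 z.2]
    rw [hz]
    simp [affineMap, Matrix.ofLp_toEuclideanCLM]
  -- Weak duality for the single coupling `π₀`, whose cost is the dual value of `quad (A, b)`, shows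
  -- that `quad (A, b)` minimizes `J`.
  have hle : ∀ f ∈ Q (fullΘ n), J μ ν (quad (A, b)) ≤ J μ ν f := by
    rintro _ ⟨⟨A', b'⟩, hA', rfl⟩
    have := dual_le_integral_cost hμ hν hπ hA' b'
    linarith
  have hbdd : BddBelow (J μ ν '' Q (fullΘ n)) :=
    ⟨J μ ν (quad (A, b)), by rintro _ ⟨f, hf, rfl⟩; exact hle f hf⟩
  have hmem : quad (A, b) ∈ Q (fullΘ n) := ⟨(A, b), hA, rfl⟩
  have hinf : ⨅ f : Q (fullΘ n), J μ ν f = J μ ν (quad (A, b)) := by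
    have : Nonempty (Q (fullΘ n)) := ⟨⟨_, hmem⟩⟩
    refine le_antisymm (ciInf_le ?_ (⟨_, hmem⟩ : Q (fullΘ n))) (le_ciInf fun f => hle f f.2)
    rwa [Set.image_eq_range] at hbdd
  have hval : W2FSq (Q (fullΘ n)) μ ν = ∫ z, 1 / 2 * ‖z.1 - z.2‖ ^ 2 ∂π₀ := by
    rw [W2FSq, hinf, hcost₀]
  have hof : ∀ π ∈ couplings μ ν, ∫⁻ z, ENNReal.ofReal (1 / 2 * ‖z.1 - z.2‖ ^ 2) ∂π =
      ENNReal.ofReal (∫ z, 1 / 2 * ‖z.1 - z.2‖ ^ 2 ∂π) := fun π hπ =>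
    (ofReal_integral_eq_lintegral_ofReal (integral_cost_eq hμ hν hπ hA b).1
      (Filter.Eventually.of_forall fun z => by positivity)).symm
  have hW : W2Sq μ ν = ENNReal.ofReal (W2FSq (Q (fullΘ n)) μ ν) := by
    refine le_antisymm ((iInf₂_le π₀ hπ).trans (by rw [hof π₀ hπ, hval]))
      (le_iInf₂ fun π hπ' => ?_)
    rw [hof π hπ', hval, hcost₀]
    exact ENNReal.ofReal_le_ofReal (dual_le_integral_cost hμ hν hπ' hA b)
  refine ⟨hW, hval ▸ integral_nonneg fun z => by positivity, hbdd, ?_⟩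
  rw [hW, hval, ← hof π₀ hπ, hπ₀, lintegral_cost_map hTm]

end moments

/-! ### Gaussian measures -/

section gaussian

variable {μ ν : Measure (E n)}

lemma mean_G (μ : Measure (E n)) : mean (G μ) = mean μ :=
  integral_id_multivariateGaussian

lemma covMatrix_G (hμ : μ ∈ P2plus n) : covMatrix (G μ) = covMatrix μ := by
  ext i j
  exact covariance_eval_multivariateGaussian hμ.2.2.posSemidef i j

instance isGaussian_G : IsGaussian (G μ) :=
  isGaussian_multivariateGaussian

lemma mem_P2plus_of_mem_nondegGaussians (hμ : μ ∈ nondegGaussians n) : μ ∈ P2plus n := by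
  have := hμ.1
  exact ⟨inferInstance, IsGaussian.memLp_two_id, hμ.2⟩

/-- Needed because `IsGaussian.ext` identifies Gaussians by mean and covariance bilinear form, not
by covariance matrix. -/
lemma covarianceBilin_eq_dotProduct [IsProbabilityMeasure μ]
    (h : MemLp (fun x : E n => x) 2 μ) (u v : E n) :
    covarianceBilin μ u v = u.ofLp ⬝ᵥ (covMatrix μ *ᵥ v.ofLp) := by
  have := covarianceBilin_apply_pi (μ := μ) (X := fun i (x : E n) => x i) (memLp_eval h) u v
  simp only [WithLp.toLp_ofLp, Measure.map_id'] at this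
  rw [this]
  simp only [dotProduct, Matrix.mulVec, covMatrix, Matrix.of_apply, Finset.mul_sum]
  exact Finset.sum_congr rfl fun i _ => Finset.sum_congr rfl fun j _ => by ring

lemma G_eq_self (hμ : μ ∈ nondegGaussians n) : G μ = μ := by
  have hP := mem_P2plus_of_mem_nondegGaussians hμ
  have := hμ.1
  refine IsGaussian.ext (mean_G μ) ?_
  ext u v
  rw [covarianceBilin_eq_dotProduct IsGaussian.memLp_two_id,
    covarianceBilin_eq_dotProduct IsGaussian.memLp_two_id, covMatrix_G hP]

/-- Two nondegenerate Gaussian measures are related by the gradient of a convex quadratic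
function. -/
lemma exists_affineMap_map_G_eq (hμ : μ ∈ P2plus n) (hν : ν ∈ P2plus n) :
    ∃ A b, A.PosDef ∧ (G μ).map (affineMap A b) = G ν := by
  obtain ⟨A, hA, hAS⟩ := exists_posDef_mul_mul_eq hμ.2.2 hν.2.2
  set L := Matrix.toEuclideanCLM (𝕜 := ℝ) A with hL
  -- Self-adjointness turns the pushforward covariance `L S₁ L*` into `A S₁ A`.
  have hLadj : L.adjoint = L := by
    have : IsSelfAdjoint L := (show IsSelfAdjoint A from hA.isHermitian).map _
    exact this.adjoint_eq
  refine ⟨A, mean ν - L (mean μ), hA, ?_⟩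
  have hcomp : affineMap A (mean ν - L (mean μ)) =
      (fun x => (mean ν - L (mean μ)) + x) ∘ L := rfl
  have hmap : (G μ).map (affineMap A (mean ν - L (mean μ))) =
      ((G μ).map L).map (fun x => (mean ν - L (mean μ)) + x) := by
    rw [hcomp, Measure.map_map (measurable_const_add _) (by fun_prop)]
  rw [hmap]
  refine IsGaussian.ext ?_ ?_
  · rw [integral_map (by fun_prop) (by fun_prop), integral_map (by fun_prop) (by fun_prop)]
    simp only [id_eq]
    rw [integral_add (integrable_const _) (L.integrable_comp IsGaussian.integrable_fun_id),
      L.integral_comp_comm IsGaussian.integrable_fun_id]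
    have h₁ := mean_G μ
    have h₂ := mean_G ν
    simp only [mean] at h₁ h₂
    simp [h₁, h₂, mean]
  · rw [covarianceBilin_map_const_add]
    ext u v
    rw [covarianceBilin_map IsGaussian.memLp_two_id, hLadj,
      covarianceBilin_eq_dotProduct IsGaussian.memLp_two_id,
      covarianceBilin_eq_dotProduct IsGaussian.memLp_two_id, covMatrix_G hμ, covMatrix_G hν,
      ← hAS, hL, Matrix.ofLp_toEuclideanCLM, Matrix.ofLp_toEuclideanCLM,
      dotProduct_comm, dotProduct_mulVec_comm hA.isHermitian]
    simp only [Matrix.mulVec_mulVec, Matrix.mul_assoc]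

end gaussian

/-! ### The distance on Gaussian measures -/

section distance

variable {μ ν ρ : Measure (E n)}

/-- `W2FSq` is unchanged when `μ` and `ν` are replaced by the Gaussian measures attached to
them. -/
lemma W2FSq_G (hμ : μ ∈ P2plus n) (hν : ν ∈ P2plus n) :
    W2FSq (Q (fullΘ n)) μ ν = W2FSq (Q (fullΘ n)) (G μ) (G ν) := by
  have := hμ.1
  have := hν.1
  exact W2FSq_congr hμ.2.1 IsGaussian.memLp_two_id hν.2.1 IsGaussian.memLp_two_id
    (mean_G μ).symm (covMatrix_G hμ).symm (mean_G ν).symm (covMatrix_G hν).symm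

theorem W2FWellDefined_Q (hμ : μ ∈ P2plus n) (hν : ν ∈ P2plus n) :
    W2FWellDefined (Q (fullΘ n)) μ ν := by
  have := hμ.1
  have := hν.1
  obtain ⟨A, b, hA, hT⟩ := exists_affineMap_map_G_eq hμ hν
  obtain ⟨-, h0, ⟨c, hc⟩, -⟩ :=
    duality_of_map_eq IsGaussian.memLp_two_id IsGaussian.memLp_two_id hA b hT
  refine ⟨⟨_, (A, b), hA, rfl⟩, ?_, ?_, ?_, ?_, ?_, ⟨c, ?_⟩, W2FSq_G hμ hν ▸ h0⟩
  · rintro _ ⟨⟨A', b'⟩, hA', rfl⟩ y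
    exact bddAbove_conj_quad hA' b' y
  · rintro _ ⟨θ, -, rfl⟩
    exact integrable_quad hμ.2.1 θ
  · rintro _ ⟨⟨A', b'⟩, hA', rfl⟩
    exact integrable_conj_quad hν.2.1 hA' b'
  · exact half_norm_sq_eq_quad ▸ integrable_quad hμ.2.1 _
  · exact half_norm_sq_eq_quad ▸ integrable_quad hν.2.1 _
  · rintro _ ⟨_, ⟨⟨A', b'⟩, hA', rfl⟩, rfl⟩
    -- The lower bound `c` comes from the Gaussian pair; it transfers since `J` depends only on the
    -- first two moments.
    have := hc ⟨_, ⟨(A', b'), hA', rfl⟩, rfl⟩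
    rwa [J_quad IsGaussian.memLp_two_id hA',
      integral_quad_congr IsGaussian.memLp_two_id hμ.2.1 (mean_G μ) (covMatrix_G hμ),
      integral_quad_congr IsGaussian.memLp_two_id hν.2.1 (mean_G ν) (covMatrix_G hν),
      ← J_quad hν.2.1 hA'] at this

theorem ofReal_W2F_eq_W2_G (hμ : μ ∈ P2plus n) (hν : ν ∈ P2plus n) :
    ENNReal.ofReal (W2F (Q (fullΘ n)) μ ν) = W2 (G μ) (G ν) := by
  obtain ⟨A, b, hA, hT⟩ := exists_affineMap_map_G_eq hμ hν
  obtain ⟨hW, h0, -, -⟩ :=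
    duality_of_map_eq IsGaussian.memLp_two_id IsGaussian.memLp_two_id hA b hT
  rw [W2, hW, W2F, W2FSq_G hμ hν, Real.sqrt_eq_rpow,
    ENNReal.ofReal_rpow_of_nonneg h0 (by norm_num)]

/-! ### Metric properties of `W2` through transport maps -/

/-- Turns the root of a transport cost into an `L²` norm, for which Minkowski's inequality is
available. -/
lemma rpow_lintegral_half_norm_sq (γ : Measure (E n)) (f : E n → E n) :
    (∫⁻ x, ENNReal.ofReal (1 / 2 * ‖f x‖ ^ 2) ∂γ) ^ (1 / 2 : ℝ) =
      ENNReal.ofReal (1 / 2) ^ (1 / 2 : ℝ) * eLpNorm f 2 γ := by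
  have h (x : E n) : ENNReal.ofReal (1 / 2 * ‖f x‖ ^ 2) =
      ENNReal.ofReal (1 / 2) * ‖f x‖ₑ ^ (2 : ℝ) := by
    rw [ENNReal.ofReal_mul (by norm_num), ENNReal.ofReal_pow (norm_nonneg _), ofReal_norm,
      ENNReal.rpow_two]
  simp_rw [h]
  rw [lintegral_const_mul' _ _ ENNReal.ofReal_ne_top,
    ENNReal.mul_rpow_of_nonneg _ _ (by norm_num),
    eLpNorm_eq_lintegral_rpow_enorm_toReal (by norm_num) (by norm_num)]
  simp

lemma W2_map_le {T : E n → E n} (hT : Measurable T) (γ : Measure (E n)) :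
    W2 γ (γ.map T) ≤ ENNReal.ofReal (1 / 2) ^ (1 / 2 : ℝ) * eLpNorm (fun x => x - T x) 2 γ := by
  rw [← rpow_lintegral_half_norm_sq, W2, ← lintegral_cost_map hT]
  exact ENNReal.rpow_le_rpow (iInf₂_le _ (map_prodMk_mem_couplings hT)) (by norm_num)

lemma W2_comm (μ ν : Measure (E n)) : W2 μ ν = W2 ν μ := by
  have h : ∀ μ ν : Measure (E n), W2Sq μ ν ≤ W2Sq ν μ := fun μ ν => by
    refine le_iInf₂ fun π hπ => (iInf₂_le (π.map Prod.swap)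
      ⟨by rw [Measure.fst_map_swap, hπ.2], by rw [Measure.snd_map_swap, hπ.1]⟩).trans (le_of_eq ?_)
    rw [lintegral_map (by fun_prop) measurable_swap]
    simp [norm_sub_rev]
  rw [W2, W2, le_antisymm (h μ ν) (h ν μ)]

lemma W2_self (μ : Measure (E n)) : W2 μ μ = 0 := by
  have h := W2_map_le (T := fun x : E n => x) measurable_id μ
  simpa using h

lemma W2_G_eq (hμ : μ ∈ P2plus n) (hν : ν ∈ P2plus n) :
    ∃ T : E n → E n, Measurable T ∧ (G μ).map T = G ν ∧
      W2 (G μ) (G ν) =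
        ENNReal.ofReal (1 / 2) ^ (1 / 2 : ℝ) * eLpNorm (fun x => x - T x) 2 (G μ) := by
  obtain ⟨A, b, hA, hT⟩ := exists_affineMap_map_G_eq hμ hν
  refine ⟨affineMap A b, (continuous_affineMap A b).measurable, hT, ?_⟩
  rw [W2, (duality_of_map_eq IsGaussian.memLp_two_id IsGaussian.memLp_two_id hA b hT).2.2.2,
    rpow_lintegral_half_norm_sq _ fun x => x - affineMap A b x]

/-- The triangle inequality, by composition of transport maps. -/
lemma W2_G_triangle (hμ : μ ∈ P2plus n) (hν : ν ∈ P2plus n) (hρ : ρ ∈ P2plus n) :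
    W2 (G μ) (G ρ) ≤ W2 (G μ) (G ν) + W2 (G ν) (G ρ) := by
  obtain ⟨T, hTm, hT, hTW⟩ := W2_G_eq hμ hν
  obtain ⟨S, hSm, hS, hSW⟩ := W2_G_eq hν hρ
  have hcomp : (G μ).map (fun x => S (T x)) = G ρ := by
    rw [← hS, ← hT, Measure.map_map hSm hTm]
    rfl
  -- Change of variables along `T` puts both displacements in `L²` of the same measure `G μ`.
  have hnorm : eLpNorm (fun x => x - S x) 2 (G ν) = eLpNorm (fun x => T x - S (T x)) 2 (G μ) := by
    rw [← hT, eLpNorm_map_measure (by fun_prop) (by fun_prop)]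
    rfl
  rw [hTW, hSW, hnorm, ← mul_add, ← hcomp]
  -- `S ∘ T` need not be optimal, but it is a transport map, so its cost bounds `W2` from above.
  refine (W2_map_le (by fun_prop) (G μ)).trans (mul_le_mul_right ?_ _)
  have hadd : (fun x => x - S (T x)) = (fun x => x - T x) + fun x => T x - S (T x) := by
    ext1 x
    simp
  rw [hadd]
  exact eLpNorm_add_le (by fun_prop) (by fun_prop) (by norm_num)

/-- The infimum is attained by a map `T`; its displacement has zero `L²` norm, so `T` is the
identity almost everywhere and pushes `G μ` to itself. -/
lemma eq_of_W2_G_eq_zero (hμ : μ ∈ P2plus n) (hν : ν ∈ P2plus n) (h : W2 (G μ) (G ν) = 0) :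
    G μ = G ν := by
  obtain ⟨T, hTm, hT, hTW⟩ := W2_G_eq hμ hν
  rw [h, eq_comm, mul_eq_zero] at hTW
  have h0 := hTW.resolve_left (by simp [ENNReal.rpow_eq_zero_iff])
  rw [eLpNorm_eq_zero_iff (by fun_prop) (by norm_num)] at h0
  rw [← hT]
  conv_lhs => rw [← Measure.map_id (μ := G μ)]
  refine Measure.map_congr ?_
  filter_upwards [h0] with x hx
  exact sub_eq_zero.1 hx

theorem isPseudometricOn_W2F : IsPseudometricOn (P2plus n) (W2F (Q (fullΘ n))) where
  nonneg _ _ _ _ := Real.sqrt_nonneg _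
  self μ hμ := by
    have h := ofReal_W2F_eq_W2_G hμ hμ
    rw [W2_self, ENNReal.ofReal_eq_zero] at h
    exact le_antisymm h (Real.sqrt_nonneg _)
  symm μ hμ ν hν := by
    have h := W2_comm (G μ) (G ν)
    rw [← ofReal_W2F_eq_W2_G hμ hν, ← ofReal_W2F_eq_W2_G hν hμ] at h
    exact (ENNReal.ofReal_eq_ofReal_iff (Real.sqrt_nonneg _) (Real.sqrt_nonneg _)).1 h
  triangle μ hμ ν hν ρ hρ := by
    have h := W2_G_triangle hμ hν hρ
    rw [← ofReal_W2F_eq_W2_G hμ hν, ← ofReal_W2F_eq_W2_G hμ hρ, ← ofReal_W2F_eq_W2_G hν hρ,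
      ← ENNReal.ofReal_add (by exact Real.sqrt_nonneg _) (by exact Real.sqrt_nonneg _)] at h
    exact (ENNReal.ofReal_le_ofReal_iff
      (add_nonneg (Real.sqrt_nonneg _) (Real.sqrt_nonneg _))).1 h

theorem isMetricOn_W2F : IsMetricOn (nondegGaussians n) (W2F (Q (fullΘ n))) := by
  have hP : ∀ μ ∈ nondegGaussians n, μ ∈ P2plus n := fun _ => mem_P2plus_of_mem_nondegGaussians
  have hps := isPseudometricOn_W2F (n := n)
  refine ⟨⟨fun μ hμ ν hν => hps.nonneg μ (hP μ hμ) ν (hP ν hν), fun μ hμ => hps.self μ (hP μ hμ),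
    fun μ hμ ν hν => hps.symm μ (hP μ hμ) ν (hP ν hν),
    fun μ hμ ν hν ρ hρ => hps.triangle μ (hP μ hμ) ν (hP ν hν) ρ (hP ρ hρ)⟩,
    fun μ hμ ν hν h => ?_⟩
  have hW := ofReal_W2F_eq_W2_G (hP μ hμ) (hP ν hν)
  rw [h, ENNReal.ofReal_zero] at hW
  rw [← G_eq_self hμ, ← G_eq_self hν]
  exact eq_of_W2_G_eq_zero (hP μ hμ) (hP ν hν) hW.symm

end distance

end QuadOT

theorem mainTheorem9 (n : ℕ) :
    (∀ μ ∈ QuadOT.P2plus n, ∀ ν ∈ QuadOT.P2plus n,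
      QuadOT.W2FWellDefined (QuadOT.Q (QuadOT.fullΘ n)) μ ν ∧
      ENNReal.ofReal (QuadOT.W2F (QuadOT.Q (QuadOT.fullΘ n)) μ ν) =
        QuadOT.W2 (QuadOT.G μ) (QuadOT.G ν)) ∧
    QuadOT.IsPseudometricOn (QuadOT.P2plus n) (QuadOT.W2F (QuadOT.Q (QuadOT.fullΘ n))) ∧
    QuadOT.IsMetricOn (QuadOT.nondegGaussians n) (QuadOT.W2F (QuadOT.Q (QuadOT.fullΘ n))) := by
  exact ⟨fun μ hμ ν hν => ⟨QuadOT.W2FWellDefined_Q hμ hν, QuadOT.ofReal_W2F_eq_W2_G hμ hν⟩,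
    QuadOT.isPseudometricOn_W2F, QuadOT.isMetricOn_W2F⟩
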